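/- For a finite group $K$ and $n\ge 0$, let $\beta_{K,n}$ be the number of orbits of $K$, acting by simultaneous conjugation $g\cdot(x_1,\dots,x_n)=(gx_1g^{-1},\dots,gx_ng^{-1})$, on the set of $n$-tuples of pairwise commuting elements of $K$, and let $B_K(t)=\sum_{n\ge 0}\beta_{K,n}t^n\in\mathbb{Q}[[t]]$. Let $G$ be a finite Frobenius group with Frobenius complement $H$ and Frobenius kernel $N$; that is, $H$ is a proper non-trivial subgroup of $G$ with $H\cap gHg^{-1}=\{1\}$ for all $g\in G\setminus H$, and $N$ is the subgroup of $G$ whose underlying set is $\bigl(G\setminus\bigcup_{g\in G}gHg^{-1}\bigr)\cup\{1\}$. Then $$(1-t)B_G(t)=1+\frac{1}{|H|}\Bigl((1-t)B_N(t)-1\Bigr)+\Bigl((1-t)B_H(t)-1\Bigr).$$ -/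

import Mathlib

open scoped PowerSeries

namespace FrobGen

/-- The set `G^(n)` of `n`-tuples of pairwise commuting elements of `G`. -/
def CommutingTuple (G : Type*) [Group G] (n : ℕ) : Type _ :=
  {x : Fin n → G // ∀ i j, Commute (x i) (x j)}

/-- `G` acts on `G^(n)` by simultaneous conjugation. -/
instance conjAction (G : Type*) [Group G] (n : ℕ) : MulAction G (CommutingTuple G n) where
  smul g x := ⟨fun i => g * x.1 i * g⁻¹, fun i j => by
    simpa using (x.2 i j).map (MulAut.conj g)⟩
  one_smul x := Subtype.ext (funext fun i => by
    change 1 * x.1 i * 1⁻¹ = x.1 i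
    simp)
  mul_smul g h x := Subtype.ext (funext fun i => by
    change g * h * x.1 i * (g * h)⁻¹ = g * (h * x.1 i * h⁻¹) * g⁻¹
    group)

/-- The number of simultaneous conjugacy classes of commuting `n`-tuples in `G`. -/
noncomputable def beta (G : Type*) [Group G] (n : ℕ) : ℕ :=
  Nat.card (MulAction.orbitRel.Quotient G (CommutingTuple G n))

/-- The generating function `B_G(t) = ∑ n, β_{G,n} t ^ n`, as a formal power series. -/
noncomputable def B (G : Type*) [Group G] : ℚ⟦X⟧ :=
  PowerSeries.mk fun n => (beta G n : ℚ)

/-- The conjugate subgroup `g H g⁻¹`. -/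
def conjSubgroup {G : Type*} [Group G] (g : G) (H : Subgroup G) : Subgroup G :=
  H.map (MulAut.conj g).toMonoidHom

/-- `H` is a Frobenius complement of `G`: a proper nontrivial subgroup with
`H ∩ g H g⁻¹ = {1}` for all `g ∈ G \ H`. -/
structure IsFrobeniusComplement {G : Type*} [Group G] (H : Subgroup G) : Prop where
  ne_bot : H ≠ ⊥
  ne_top : H ≠ ⊤
  inf_conj : ∀ g : G, g ∉ H → H ⊓ conjSubgroup g H = ⊥

/-- The subset `(G \ ⋃ g, g H g⁻¹) ∪ {1}` of `G`, the Frobenius kernel with respect to `H`. -/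
def frobeniusKernel {G : Type*} [Group G] (H : Subgroup G) : Set G :=
  (Set.univ \ ⋃ g : G, (conjSubgroup g H : Set G)) ∪ {1}

end FrobGen

/-! By Burnside's lemma (`card_succ`), `|G^(n+1)| = β_{G,n} |G|`, so it suffices to count commuting
tuples. In a Frobenius group the centralizer of a nontrivial element of `N`, or of a conjugate of
`H`, stays inside that subgroup. Hence a nontrivial commuting tuple lies in exactly one of `N` and
the `[G : H]` conjugates of `H`, which gives `card_commutingTuple_frobenius`. Length 1 yields `|N| =
[G : H]`; length `n + 1`, divided by `|G| = |H| |N|`, yields the identity coefficientwise. -/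

namespace FrobGen

namespace CommutingTuple

variable {G K : Type*} [Group G] [Group K] {n : ℕ}

instance [Finite G] : Finite (CommutingTuple G n) :=
  inferInstanceAs (Finite {x : Fin n → G // ∀ i j, Commute (x i) (x j)})

instance : One (CommutingTuple G n) :=
  ⟨⟨fun _ => 1, fun _ _ => Commute.one_left 1⟩⟩

/-- The image of a commuting tuple under a group homomorphism. -/
def map (f : G →* K) (x : CommutingTuple G n) : CommutingTuple K n :=
  ⟨fun i => f (x.1 i), fun i j => (x.2 i j).map f⟩

theorem exists_ne_one {x : CommutingTuple G n} (hx : x ≠ 1) : ∃ i, x.1 i ≠ 1 := by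
  by_contra! h
  exact hx (Subtype.ext (funext h))

theorem ne_one_of_apply {x : CommutingTuple G n} {i : Fin n} (hx : x.1 i ≠ 1) : x ≠ 1 := by
  rintro rfl
  exact hx rfl

theorem map_injective {f : G →* K} (hf : Function.Injective f) :
    Function.Injective (map (n := n) f) := fun _ _ h =>
  Subtype.ext (funext fun i => hf (congrFun (congrArg Subtype.val h) i))

theorem map_ne_one {f : G →* K} (hf : Function.Injective f) {x : CommutingTuple G n}
    (hx : x ≠ 1) : map f x ≠ 1 := by
  obtain ⟨i, hi⟩ := exists_ne_one hx
  exact ne_one_of_apply (i := i) fun h => hi (hf (h.trans f.map_one.symm))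

theorem exists_map_eq {f : G →* K} (hf : Function.Injective f) {y : CommutingTuple K n}
    (hy : ∀ i, y.1 i ∈ f.range) : ∃ x : CommutingTuple G n, map f x = y := by
  choose x hx using hy
  refine ⟨⟨x, fun i j => hf ?_⟩, Subtype.ext (funext hx)⟩
  simpa [hx] using (y.2 i j).eq

theorem mem_fixedBy_iff {g : G} {x : CommutingTuple G n} :
    x ∈ MulAction.fixedBy (CommutingTuple G n) g ↔ ∀ i, Commute g (x.1 i) := by
  rw [MulAction.mem_fixedBy]
  refine (Subtype.ext_iff.trans funext_iff).trans (forall_congr' fun i => ?_)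
  change g * x.1 i * g⁻¹ = x.1 i ↔ _
  rw [mul_inv_eq_iff_eq_mul]
  rfl

/-- A commuting `n`-tuple centralized by `g` is a commuting `(n + 1)`-tuple with head `g`. -/
def sigmaFixedByEquiv (G : Type*) [Group G] (n : ℕ) :
    (Σ g : G, MulAction.fixedBy (CommutingTuple G n) g) ≃ CommutingTuple G (n + 1) where
  toFun p := ⟨Fin.cons p.1 p.2.1.1, fun i j => by
    have h := mem_fixedBy_iff.1 p.2.2
    refine Fin.cases (Fin.cases ?_ (fun j => ?_) j) (fun i => Fin.cases ?_ (fun j => ?_) j) i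
    · exact Commute.refl _
    · exact h j
    · exact (h i).symm
    · exact p.2.1.2 i j⟩
  invFun x := ⟨x.1 0, ⟨Fin.tail x.1, fun i j => x.2 i.succ j.succ⟩,
    mem_fixedBy_iff.2 fun i => x.2 0 i.succ⟩
  left_inv _ := rfl
  right_inv x := Subtype.ext (Fin.cons_self_tail x.1)

theorem card_succ (G : Type*) [Group G] (n : ℕ) :
    Nat.card (CommutingTuple G (n + 1)) = beta G n * Nat.card G := by
  rw [← Nat.card_congr (sigmaFixedByEquiv G n),
    Nat.card_congr (MulAction.sigmaFixedByEquivOrbitsProdGroup G (CommutingTuple G n)),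
    Nat.card_prod]
  rfl

theorem card_one (G : Type*) [Group G] : Nat.card (CommutingTuple G 1) = Nat.card G :=
  Nat.card_congr
    { toFun := fun x => x.1 0
      invFun := fun g => ⟨fun _ => g, fun _ _ => Commute.refl g⟩
      left_inv := fun x => Subtype.ext (funext fun i => by rw [Subsingleton.elim i 0])
      right_inv := fun _ => rfl }

theorem card_ne_one_add_one (G : Type*) [Group G] [Finite G] (n : ℕ) :
    Nat.card {x : CommutingTuple G n // x ≠ 1} + 1 = Nat.card (CommutingTuple G n) := by
  classical
  have := Fintype.ofFinite (CommutingTuple G n)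
  have := Fintype.card_pos_iff.2 ⟨(1 : CommutingTuple G n)⟩
  simp only [Nat.card_eq_fintype_card, Fintype.card_subtype_compl, Fintype.card_subtype_eq]
  omega

end CommutingTuple

section Frobenius

variable {G : Type*} [Group G] {N H : Subgroup G}

theorem mem_conjSubgroup {g x : G} : x ∈ conjSubgroup g H ↔ g⁻¹ * x * g ∈ H := by
  constructor
  · rintro ⟨h, hh, rfl⟩
    simpa [mul_assoc] using hh
  · exact fun h => ⟨_, h, by simp [mul_assoc]⟩

/-- Conjugating by `a⁻¹` moves `x` into `H ∩ cHc⁻¹` with `c = a⁻¹b`. So conjugates from distinct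
cosets meet trivially. -/
theorem IsFrobeniusComplement.inv_mul_mem (hH : IsFrobeniusComplement H) {a b x : G}
    (ha : x ∈ conjSubgroup a H) (hb : x ∈ conjSubgroup b H) (hx : x ≠ 1) : a⁻¹ * b ∈ H := by
  by_contra h
  have hmem : a⁻¹ * x * a ∈ H ⊓ conjSubgroup (a⁻¹ * b) H := by
    refine ⟨mem_conjSubgroup.1 ha, mem_conjSubgroup.2 ?_⟩
    have := mem_conjSubgroup.1 hb
    convert this using 1
    group
  rw [hH.inf_conj _ h, Subgroup.mem_bot] at hmem
  apply hx
  simpa [mul_assoc, inv_mul_eq_one, eq_comm] using hmem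

/-- Since `y` fixes `x`, `x` also lies in the conjugate by `y * g`, so `g` and `y * g` share a coset
of `H`. -/
theorem IsFrobeniusComplement.mem_conjSubgroup_of_commute (hH : IsFrobeniusComplement H)
    {g x y : G} (hx : x ∈ conjSubgroup g H) (hx1 : x ≠ 1) (hxy : Commute x y) :
    y ∈ conjSubgroup g H := by
  rw [mem_conjSubgroup, mul_assoc]
  refine hH.inv_mul_mem hx (mem_conjSubgroup.2 ?_) hx1
  have : (y * g)⁻¹ * x * (y * g) = g⁻¹ * x * g := by
    rw [mul_inv_rev, mul_assoc _ x, ← mul_assoc x, hxy.eq]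
    group
  rw [this]
  exact mem_conjSubgroup.1 hx

theorem mem_iff_of_ne_one (hN : (N : Set G) = frobeniusKernel H) {x : G} (hx : x ≠ 1) :
    x ∈ N ↔ ∀ g, x ∉ conjSubgroup g H := by
  rw [← SetLike.mem_coe, hN]
  simp [frobeniusKernel, hx]

theorem IsFrobeniusComplement.mem_kernel_of_commute (hH : IsFrobeniusComplement H)
    (hN : (N : Set G) = frobeniusKernel H) {x y : G} (hx : x ∈ N) (hx1 : x ≠ 1)
    (hxy : Commute x y) : y ∈ N := by
  by_cases hy1 : y = 1
  · exact hy1 ▸ N.one_mem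
  · rw [mem_iff_of_ne_one hN hy1]
    exact fun g hg =>
      (mem_iff_of_ne_one hN hx1).1 hx g (hH.mem_conjSubgroup_of_commute hg hy1 hxy.symm)

/-- The embedding of `H` into `G` followed by conjugation by `g`. -/
def conjHom (H : Subgroup G) (g : G) : H →* G :=
  (MulAut.conj g).toMonoidHom.comp H.subtype

theorem conjHom_injective (g : G) : Function.Injective (conjHom H g) :=
  (MulAut.conj g).injective.comp H.subtype_injective

theorem conjHom_range (g : G) : (conjHom H g).range = conjSubgroup g H := by
  rw [conjHom, MonoidHom.range_comp, H.range_subtype]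
  rfl

theorem conjHom_mem (g : G) (h : H) : conjHom H g h ∈ conjSubgroup g H :=
  conjHom_range (H := H) g ▸ ⟨h, rfl⟩

open CommutingTuple

/-- Nontrivial commuting tuples of `N` and of the conjugates of `H`, as tuples of `G`. -/
noncomputable def frobeniusTuple (N H : Subgroup G) (n : ℕ) :
    {x : CommutingTuple N n // x ≠ 1} ⊕ (G ⧸ H) × {x : CommutingTuple H n // x ≠ 1} →
      {x : CommutingTuple G n // x ≠ 1} :=
  Sum.elim (fun x => ⟨x.1.map N.subtype, map_ne_one N.subtype_injective x.2⟩)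
    fun p => ⟨p.2.1.map (conjHom H p.1.out), map_ne_one (conjHom_injective _) p.2.2⟩

theorem frobeniusTuple_injective (hH : IsFrobeniusComplement H)
    (hN : (N : Set G) = frobeniusKernel H) (n : ℕ) :
    Function.Injective (frobeniusTuple N H n) := by
  refine Function.Injective.sumElim ?_ ?_ ?_
  · exact fun x y h => Subtype.ext (map_injective N.subtype_injective (congrArg Subtype.val h))
  · rintro ⟨p, x, hx⟩ ⟨q, y, hy⟩ h
    have h' : map (conjHom H p.out) x = map (conjHom H q.out) y := congrArg Subtype.val h
    have hpq : p = q := by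
      obtain ⟨i, hi⟩ := exists_ne_one (map_ne_one (conjHom_injective p.out) hx)
      rw [← p.out_eq', ← q.out_eq']
      refine QuotientGroup.eq.2 (hH.inv_mul_mem (conjHom_mem _ (x.1 i)) ?_ hi)
      have hi' : conjHom H p.out (x.1 i) = conjHom H q.out (y.1 i) :=
        congrFun (congrArg Subtype.val h') i
      exact hi' ▸ conjHom_mem _ _
    subst hpq
    obtain rfl := map_injective (conjHom_injective p.out) h'
    rfl
  · rintro ⟨x, hx⟩ ⟨q, y, hy⟩ h
    obtain ⟨i, hi⟩ := exists_ne_one (map_ne_one N.subtype_injective hx)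
    have hi' : (x.1 i : G) = conjHom H q.out (y.1 i) :=
      congrFun (congrArg Subtype.val (congrArg Subtype.val h)) i
    refine (mem_iff_of_ne_one hN hi).1 (x.1 i).2 q.out ?_
    change (x.1 i : G) ∈ _
    exact hi' ▸ conjHom_mem _ _

theorem frobeniusTuple_surjective (hH : IsFrobeniusComplement H)
    (hN : (N : Set G) = frobeniusKernel H) (n : ℕ) :
    Function.Surjective (frobeniusTuple N H n) := by
  rintro ⟨x, hx⟩
  obtain ⟨i, hi⟩ := exists_ne_one hx
  by_cases hiN : x.1 i ∈ N
  · obtain ⟨y, rfl⟩ := exists_map_eq N.subtype_injective (y := x) fun j => by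
      rw [N.range_subtype]
      exact hH.mem_kernel_of_commute hN hiN hi (x.2 i j)
    refine ⟨Sum.inl ⟨y, ?_⟩, rfl⟩
    rintro rfl
    exact hi rfl
  · rw [mem_iff_of_ne_one hN hi] at hiN
    push Not at hiN
    obtain ⟨g, hg⟩ := hiN
    -- The chosen representative differs from `g` by a right factor in `H`, which does not change
    -- the conjugate.
    have hout : x.1 i ∈ conjSubgroup (g : G ⧸ H).out H := by
      obtain ⟨h, hh⟩ := QuotientGroup.mk_out_eq_mul H g
      rw [hh, mem_conjSubgroup]
      have := H.mul_mem (H.mul_mem (H.inv_mem h.2) (mem_conjSubgroup.1 hg)) h.2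
      convert this using 1
      group
    obtain ⟨y, rfl⟩ := exists_map_eq (conjHom_injective (H := H) (g : G ⧸ H).out) (y := x)
      fun j => by
        rw [conjHom_range]
        exact hH.mem_conjSubgroup_of_commute hout hi (x.2 i j)
    refine ⟨Sum.inr ⟨(g : G ⧸ H), y, ?_⟩, rfl⟩
    rintro rfl
    exact hi (map_one _)

theorem card_commutingTuple_frobenius [Finite G] (hH : IsFrobeniusComplement H)
    (hN : (N : Set G) = frobeniusKernel H) (n : ℕ) :
    (Nat.card (CommutingTuple G n) : ℚ) - 1 = (Nat.card (CommutingTuple N n) - 1) +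
      H.index * (Nat.card (CommutingTuple H n) - 1) := by
  have h := Nat.card_congr (Equiv.ofBijective _
    ⟨frobeniusTuple_injective hH hN n, frobeniusTuple_surjective hH hN n⟩)
  rw [Nat.card_sum, Nat.card_prod] at h
  simp only [← card_ne_one_add_one, ← h, Subgroup.index]
  push_cast
  ring

theorem card_kernel_eq_index [Finite G] (hH : IsFrobeniusComplement H)
    (hN : (N : Set G) = frobeniusKernel H) : (Nat.card N : ℚ) = H.index := by
  have h := card_commutingTuple_frobenius hH hN 1
  simp only [card_one] at h
  have h' : (Nat.card H : ℚ) * H.index = Nat.card G := mod_cast H.card_mul_index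
  linear_combination -h - h'

theorem beta_sub_one_frobenius [Finite G] (hH : IsFrobeniusComplement H)
    (hN : (N : Set G) = frobeniusKernel H) (n : ℕ) :
    (beta G n : ℚ) - 1 = 1 / Nat.card H * (beta N n - 1) + (beta H n - 1) := by
  have h := card_commutingTuple_frobenius hH hN (n + 1)
  have hi : (H.index : ℚ) ≠ 0 := Nat.cast_ne_zero.2 H.index_ne_zero_of_finite
  have hc : (Nat.card H : ℚ) ≠ 0 := Nat.cast_ne_zero.2 Nat.card_pos.ne'
  simp only [card_succ, Nat.cast_mul, card_kernel_eq_index hH hN, ← H.card_mul_index] at h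
  field_simp
  refine mul_left_cancel₀ hi ?_
  linear_combination h

end Frobenius

end FrobGen

theorem theorem9p3 {G : Type*} [Group G] [Finite G] (N H : Subgroup G)
    (hH : FrobGen.IsFrobeniusComplement H)
    (hN : (N : Set G) = FrobGen.frobeniusKernel H) :
    (1 - PowerSeries.X) * FrobGen.B G =
      1 + PowerSeries.C (1 / (Nat.card H : ℚ)) * ((1 - PowerSeries.X) * FrobGen.B N - 1)
        + ((1 - PowerSeries.X) * FrobGen.B H - 1) := by
  -- `PowerSeries.mk 1` is `1/(1 - t)`, so each `(1 - t)B - 1` is `1 - t` times a series with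
  -- coefficients `β - 1`.
  have hE : (PowerSeries.mk 1 : ℚ⟦X⟧) * (1 - PowerSeries.X) = 1 :=
    PowerSeries.mk_one_mul_one_sub_eq_one ℚ
  have hB : FrobGen.B G - PowerSeries.mk 1 =
      PowerSeries.C (1 / (Nat.card H : ℚ)) * (FrobGen.B N - PowerSeries.mk 1) +
        (FrobGen.B H - PowerSeries.mk 1) := by
    ext n
    simpa [FrobGen.B, PowerSeries.coeff_C_mul] using FrobGen.beta_sub_one_frobenius hH hN n
  linear_combination (1 - PowerSeries.X) * hB - PowerSeries.C (1 / (Nat.card H : ℚ)) * hE
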